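/- Let $\mathbb K$ be $\mathbb R$ or $\mathbb C$, and let all Banach spaces be over $\mathbb K$. For $1\le p\le\infty$ let $p^*$ be the conjugate exponent, $\frac1p+\frac1{p^*}=1$, and let $r_i(t)=\operatorname{sign}(\sin(2^i\pi t))$, $i\ge 1$, be the Rademacher functions. For a finite or infinite sequence $(x_i)$ in a Banach space $E$, write $\|(x_i)\|_p=\big(\sum_i\|x_i\|^p\big)^{1/p}$ (with $\|(x_i)\|_\infty=\sup_i\|x_i\|$) and $\|(x_i)\|_{w,p}=\sup_{\|x^*\|\le1}\|(x^*(x_i))\|_p$, the supremum being over the closed unit ball of $E^*$. Let $X$ and $Y$ be Banach spaces. Denote by $\Pi_{al.s}(X,Y)$ the set of continuous linear operators $u:X\to Y$ that are almost summing, i.e. for which there is a constant $C\ge0$ such that $$\Big(\int_0^1\Big\|\sum_{i=1}^m r_i(t)u(x_i)\Big\|^2dt\Big)^{1/2}\le C\,\|(x_i)_{i=1}^m\|_{w,2}$$ for all $m\in\mathbb N$ and $x_1,\dots,x_m\in X$. For $1<q\le\infty$, denote by $\mathcal D_q(X,Y)$ the set of continuous linear operators $u:X\to Y$ that are Cohen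 strongly $q$-summing, i.e. for which every sequence $(x_i)_{i=1}^\infty$ in $X$ with $\|(x_i)\|_q<\infty$ satisfies $$\sup\Big\{\sum_{i=1}^\infty|y_i^*(u(x_i))| : (y_i^*)_{i=1}^\infty\subset Y^*,\ \|(y_i^*)\|_{w,q^*}\le1\Big\}<\infty .$$ **Theorem.** For every Banach space $X$ the following are equivalent: (i) $X$ is isomorphic (linearly homeomorphic) to a Hilbert space; (ii) $\Pi_{al.s}(X,Y)\subseteq\mathcal D_q(X,Y)$ for every $1<q\le\infty$ and every Banach space $Y$; (iii) $\Pi_{al.s}(X,Y)\subseteq\mathcal D_2(X,Y)$ for every Banach space $Y$. -/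

import Mathlib

open scoped ENNReal NNReal

universe w u v

namespace SummingOperators

noncomputable section

/-- The `n`-th Rademacher function `t ↦ sign (sin (2 ^ n π t))`, `n = 1, 2, …`, indexed here
from `0`. -/
def rademacher (i : ℕ) (t : ℝ) : ℝ := Real.sign (Real.sin (2 ^ (i + 1) * Real.pi * t))

/-- The (possibly infinite) `ℓ_p`-norm `(∑ ‖x i‖ ^ p) ^ (1 / p)`, or `sup ‖x i‖` for `p = ∞`, of
a finite or infinite family of vectors, for `1 ≤ p ≤ ∞`. -/
def strongNorm {ι E : Type*} [NormedAddCommGroup E] (p : ℝ≥0∞) (x : ι → E) : ℝ≥0∞ :=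
  if p = ∞ then ⨆ i, ‖x i‖ₑ else (∑' i, ‖x i‖ₑ ^ p.toReal) ^ (1 / p.toReal)

variable (𝕜 : Type*) [RCLike 𝕜]

/-- The weak `ℓ_p`-norm: the supremum, over the closed unit ball of the dual of `E`, of the
`ℓ_p`-norms of the scalar families `(φ (x i))`. -/
def weakNorm {ι E : Type*} [NormedAddCommGroup E] [NormedSpace 𝕜 E]
    (p : ℝ≥0∞) (x : ι → E) : ℝ≥0∞ :=
  ⨆ φ : StrongDual 𝕜 E, ⨆ _ : ‖φ‖ ≤ 1, strongNorm p (fun i => φ (x i))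

/-- The Cohen norm of a sequence: the supremum of `∑ |φ i (x i)|` over the sequences `φ` in the
closed unit ball of the space of weakly `p*`-summable sequences of functionals. -/
def cohenNorm {E : Type*} [NormedAddCommGroup E] [NormedSpace 𝕜 E]
    (p : ℝ≥0∞) (x : ℕ → E) : ℝ≥0∞ :=
  ⨆ φ : ℕ → StrongDual 𝕜 E, ⨆ _ : weakNorm 𝕜 p.conjExponent φ ≤ 1,
    strongNorm 1 (fun i => φ i (x i))

/-- The Rademacher norm `(∫₀¹ ‖∑ r_i(t) x_i‖² dt) ^ (1 / 2)` of a finite family. -/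
def radNorm {E : Type*} [NormedAddCommGroup E] [NormedSpace 𝕜 E]
    {m : ℕ} (x : Fin m → E) : ℝ≥0∞ :=
  (∫⁻ t in Set.Icc (0 : ℝ) 1, ‖∑ i : Fin m, (rademacher i t : 𝕜) • x i‖ₑ ^ 2) ^ (1 / 2 : ℝ)

variable (X : Type u) [NormedAddCommGroup X] [NormedSpace 𝕜 X]
  (Y : Type v) [NormedAddCommGroup Y] [NormedSpace 𝕜 Y]

/-- The almost `p`-summing operators from `X` to `Y`, for `1 ≤ p < ∞`. -/
def almostPSumming (p : ℝ≥0∞) : Set (X →L[𝕜] Y) :=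
  {u | ∃ C : ℝ≥0, ∀ (m : ℕ) (x : Fin m → X),
    radNorm 𝕜 (fun i => u (x i)) ≤ C * weakNorm 𝕜 p x}

/-- The almost summing operators: the case `p = 2`. -/
def almostSumming : Set (X →L[𝕜] Y) := almostPSumming 𝕜 X Y 2

/-- The Cohen strongly `p`-summing operators, for `1 < p ≤ ∞`: those mapping every absolutely
`p`-summable sequence to a Cohen strongly `p`-summable sequence. -/
def cohenStronglySumming (p : ℝ≥0∞) : Set (X →L[𝕜] Y) :=
  {u | ∀ x : ℕ → X, strongNorm p x < ∞ → cohenNorm 𝕜 p (fun i => u (x i)) < ∞}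

/-- `X` is isomorphic, as a topological vector space over `𝕜`, to a Hilbert space. -/
def IsIsomorphicToHilbert : Prop :=
  ∃ (H : Type u) (_ : NormedAddCommGroup H) (_ : InnerProductSpace 𝕜 H) (_ : CompleteSpace H),
    Nonempty (X ≃L[𝕜] H)

end

end SummingOperators

/-!
The implication from a Hilbert space `X` to the inclusions rests on Khinchine's inequality. For
`b` orthonormal, `u` almost summing and `W t = ∑ₖ r_k(t) u (b k)`, it gives
`(∑ₖ |φ (u (b k))|²) ^ (1 / 2) ≤ 2 ∫ |φ (W t)| dt` for every functional `φ`, while `∫ ‖W t‖ dt` is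
bounded independently of `b`. Hence `∑ᵢ |φᵢ (u xᵢ)|` is at most twice the mean of
`∑ᵢ ‖xᵢ‖ |φᵢ (W t)|`, to which Hölder's inequality applies for each fixed `t`
(`sum_enorm_apply_le_of_hilbert`).

Conversely, suppose that almost summing operators on `X` are Cohen strongly `2`-summing. An operator
into a Hilbert space that is dominated by functionals with square summable norms is almost summing,
because the Rademacher functions are orthonormal (`radNorm_le_of_le_tsum`). A gliding hump argument
turns the hypothesis into a uniform trace estimate for such operators of finite rank
(`exists_trace_bound`). Operators of the form `aᵀ G`, with `a` a contractive matrix and `G` built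
from functionals norming `x₁, …, xₘ`, then give
`∑ ‖xⱼ‖² ≤ C ∑ ‖zₖ‖²` whenever `∑ |f xⱼ|² = ∑ |f zₖ|²` for all functionals `f`
(`exists_sum_norm_sq_le`). This is the criterion of Lindenstrauss-Pełczyński and Kwapień: by M.
Riesz's extension theorem there is a linear functional `L` on real functions on the dual with
`‖x‖² ≤ L (|· x|²) ≤ C ‖x‖²` (`exists_linear_sandwich`), and `L` applied to `f ↦ conj (f x) * f y`
is an inner product defining the topology of `X`.
-/

/-! ### Rademacher sums -/

namespace SummingOperators

open MeasureTheory Set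

lemma measurable_rademacher (i : ℕ) : Measurable (rademacher i) := by
  have hs : Measurable Real.sign := by
    unfold Real.sign
    exact Measurable.ite measurableSet_Iio measurable_const
      (Measurable.ite measurableSet_Ioi measurable_const measurable_const)
  unfold rademacher
  exact hs.comp (by fun_prop)

lemma rademacher_succ (i : ℕ) (t : ℝ) : rademacher (i + 1) t = rademacher i (2 * t) := by
  unfold rademacher
  congr 2
  ring

lemma rademacher_sub_one (i : ℕ) (t : ℝ) : rademacher i (t - 1) = rademacher i t := by
  unfold rademacher
  congr 1
  have h : (2 : ℝ) ^ (i + 1) * Real.pi * (t - 1)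
      = 2 ^ (i + 1) * Real.pi * t - (2 ^ i : ℕ) * (2 * Real.pi) := by
    push_cast
    ring
  rw [h, Real.sin_sub_nat_mul_two_pi]

lemma rademacher_zero_of_lt {t : ℝ} (h : t ∈ Ioo (0 : ℝ) (1 / 2)) : rademacher 0 t = 1 := by
  unfold rademacher
  refine Real.sign_of_pos (Real.sin_pos_of_pos_of_lt_pi ?_ ?_)
  · have := h.1
    positivity
  · have := h.2
    rw [zero_add, pow_one]
    nlinarith [Real.pi_pos]

lemma rademacher_zero_of_gt {t : ℝ} (h : t ∈ Ioo (1 / 2 : ℝ) 1) : rademacher 0 t = -1 := by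
  unfold rademacher
  refine Real.sign_of_neg ?_
  rw [zero_add, pow_one]
  have h1 := h.1
  have h2 := h.2
  have h3 : 0 < Real.sin (2 * Real.pi * t - Real.pi) :=
    Real.sin_pos_of_pos_of_lt_pi (by nlinarith [Real.pi_pos]) (by nlinarith [Real.pi_pos])
  rw [Real.sin_sub_pi] at h3
  linarith

lemma setLIntegral_Ioo_comp_two_mul_sub (K : ℝ → ℝ≥0∞) (a b c : ℝ) :
    ∫⁻ t in Ioo a b, K (2 * t - c) = 2⁻¹ * ∫⁻ s in Ioo (2 * a - c) (2 * b - c), K s := by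
  let e : ℝ ≃ᵐ ℝ := (Homeomorph.mulLeft₀ (2 : ℝ) two_ne_zero).toMeasurableEquiv
  have hmap : (volume : Measure ℝ).map e = (2⁻¹ : ℝ≥0∞) • volume := by
    have h := Real.map_volume_mul_left (two_ne_zero (α := ℝ))
    rw [abs_of_pos (by norm_num), ENNReal.ofReal_inv_of_pos (by norm_num)] at h
    simpa [e] using h
  have h1 : ∫⁻ s in Ioo (2 * a - c) (2 * b - c), K s
      = ∫⁻ s, (Ioo (2 * a) (2 * b)).indicator (fun s => K (s - c)) s := by
    rw [← lintegral_indicator measurableSet_Ioo, ← lintegral_sub_right_eq_self _ c]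
    refine lintegral_congr fun s => ?_
    simp [indicator, sub_lt_sub_iff_right]
  have h2 : ∫⁻ s, (Ioo (2 * a) (2 * b)).indicator (fun s => K (s - c)) s ∂(volume.map e)
      = ∫⁻ t in Ioo a b, K (2 * t - c) := by
    rw [lintegral_map_equiv, ← lintegral_indicator measurableSet_Ioo]
    refine lintegral_congr fun s => ?_
    simp [indicator, e]
  rw [← h2, hmap, lintegral_smul_measure, h1, smul_eq_mul]

/-- Independence of the first Rademacher function from the later ones, which are jointly
distributed as the whole sequence. All statements about Rademacher sums below follow from it by
induction. No measurability of `G` is needed. -/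
lemma lintegral_rademacher_succ (G : ℝ → (ℕ → ℝ) → ℝ≥0∞) :
    ∫⁻ t in Icc (0 : ℝ) 1, G (rademacher 0 t) (fun i => rademacher (i + 1) t)
      = 2⁻¹ * ((∫⁻ t in Icc (0 : ℝ) 1, G 1 (fun i => rademacher i t))
        + ∫⁻ t in Icc (0 : ℝ) 1, G (-1) (fun i => rademacher i t)) := by
  have hI : ∀ f : ℝ → ℝ≥0∞, ∫⁻ t in Icc (0 : ℝ) 1, f t = ∫⁻ t in Ioo (0 : ℝ) 1, f t :=
    fun f => setLIntegral_congr Ioo_ae_eq_Icc.symm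
  have hU : Ioo (0 : ℝ) 1 = Ioc 0 (1 / 2) ∪ Ioo (1 / 2) 1 :=
    (Ioc_union_Ioo_eq_Ioo (by norm_num) (by norm_num)).symm
  have hd : Disjoint (Ioc (0 : ℝ) (1 / 2)) (Ioo (1 / 2) 1) := by
    rw [Set.disjoint_left]
    intro t h1 h2
    exact absurd h1.2 (not_le.2 h2.1)
  simp only [hI]
  rw [hU, lintegral_union measurableSet_Ioo hd, ← hU, setLIntegral_congr Ioo_ae_eq_Ioc.symm, mul_add]
  congr 1
  · rw [setLIntegral_congr_fun (g := fun t => (fun s => G 1 (fun i => rademacher i s)) (2 * t - 0))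
      measurableSet_Ioo, setLIntegral_Ioo_comp_two_mul_sub (fun s => G 1 (fun i => rademacher i s))]
    · norm_num
    · intro t ht
      simp only [rademacher_zero_of_lt ht, rademacher_succ, sub_zero]
  · rw [setLIntegral_congr_fun
      (g := fun t => (fun s => G (-1) (fun i => rademacher i s)) (2 * t - 1))
      measurableSet_Ioo, setLIntegral_Ioo_comp_two_mul_sub (fun s => G (-1) (fun i => rademacher i s))]
    · norm_num
    · intro t ht
      simp only [rademacher_zero_of_gt ht, rademacher_succ, rademacher_sub_one]

section RademacherSums

variable {𝕜 : Type*} [RCLike 𝕜]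

lemma stronglyMeasurable_rademacher_sum {E : Type*} [NormedAddCommGroup E] [NormedSpace 𝕜 E]
    {m : ℕ} (x : Fin m → E) :
    StronglyMeasurable fun t => ∑ i : Fin m, (rademacher i t : 𝕜) • x i := by
  refine Finset.stronglyMeasurable_fun_sum _ fun i _ => ?_
  exact StronglyMeasurable.smul_const
    (RCLike.continuous_ofReal.measurable.comp (measurable_rademacher i)).stronglyMeasurable (x i)

lemma lintegral_rademacher_sum_succ {E : Type*} [NormedAddCommGroup E] [NormedSpace 𝕜 E]
    (f : E → ℝ≥0∞) {m : ℕ} (y : E) (x : Fin (m + 1) → E) :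
    ∫⁻ t in Icc (0 : ℝ) 1, f (y + ∑ i : Fin (m + 1), (rademacher i t : 𝕜) • x i)
      = 2⁻¹ * ((∫⁻ t in Icc (0 : ℝ) 1, f ((y + x 0) + ∑ i : Fin m, (rademacher i t : 𝕜) • x i.succ))
        + ∫⁻ t in Icc (0 : ℝ) 1,
            f ((y - x 0) + ∑ i : Fin m, (rademacher i t : 𝕜) • x i.succ)) := by
  have h := lintegral_rademacher_succ
    (fun c r => f ((y + (c : 𝕜) • x 0) + ∑ i : Fin m, (r i : 𝕜) • x i.succ))
  simp only [RCLike.ofReal_one, one_smul, RCLike.ofReal_neg, neg_smul, ← sub_eq_add_neg] at h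
  rw [← h]
  simp only [Fin.sum_univ_succ, Fin.val_succ, Fin.val_zero, add_assoc]

/-- Orthogonality of the Rademacher functions, with values in a Hilbert space. -/
lemma lintegral_rademacher_sum_sq {H : Type*} [NormedAddCommGroup H] [InnerProductSpace 𝕜 H]
    {m : ℕ} (y : H) (x : Fin m → H) :
    ∫⁻ t in Icc (0 : ℝ) 1, ‖y + ∑ i : Fin m, (rademacher i t : 𝕜) • x i‖ₑ ^ 2
      = ENNReal.ofReal (‖y‖ ^ 2 + ∑ i, ‖x i‖ ^ 2) := by
  induction m generalizing y with
  | zero => simp [← ofReal_norm, ENNReal.ofReal_pow]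
  | succ m ih =>
    rw [lintegral_rademacher_sum_succ (𝕜 := 𝕜) (fun z => ‖z‖ₑ ^ 2), ih, ih,
      ← ENNReal.ofReal_add (by positivity) (by positivity),
      show (2⁻¹ : ℝ≥0∞) = ENNReal.ofReal 2⁻¹ by
        rw [ENNReal.ofReal_inv_of_pos (by norm_num)]; norm_num,
      ← ENNReal.ofReal_mul (by norm_num), Fin.sum_univ_succ]
    congr 1
    have := parallelogram_law_with_norm 𝕜 y (x 0)
    linarith

/-- A fourth moment bound, with the constant term `y` kept to make the induction work. -/
lemma lintegral_rademacher_sum_pow_four {m : ℕ} (y : 𝕜) (a : Fin m → 𝕜) :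
    ∫⁻ t in Icc (0 : ℝ) 1, ‖y + ∑ i : Fin m, (rademacher i t : 𝕜) • a i‖ₑ ^ 4
      ≤ ENNReal.ofReal (‖y‖ ^ 4 + 6 * ‖y‖ ^ 2 * (∑ i, ‖a i‖ ^ 2) + 3 * (∑ i, ‖a i‖ ^ 2) ^ 2) := by
  induction m generalizing y with
  | zero => simp [← ofReal_norm, ENNReal.ofReal_pow]
  | succ m ih =>
    rw [lintegral_rademacher_sum_succ (𝕜 := 𝕜) (fun z => ‖z‖ₑ ^ 4)]
    refine (mul_le_mul_right (add_le_add (ih _ _) (ih _ _)) _).trans ?_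
    rw [← ENNReal.ofReal_add (by positivity) (by positivity),
      show (2⁻¹ : ℝ≥0∞) = ENNReal.ofReal 2⁻¹ by
        rw [ENNReal.ofReal_inv_of_pos (by norm_num)]; norm_num,
      ← ENNReal.ofReal_mul (by norm_num), Fin.sum_univ_succ]
    refine ENNReal.ofReal_le_ofReal ?_
    have h1 := parallelogram_law_with_norm 𝕜 y (a 0)
    have h2 : ‖y + a 0‖ ≤ ‖y‖ + ‖a 0‖ := norm_add_le _ _
    have h3 : ‖y - a 0‖ ≤ ‖y‖ + ‖a 0‖ := norm_sub_le _ _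
    have hy := norm_nonneg y
    have ha := norm_nonneg (a 0)
    have hS : 0 ≤ ∑ i : Fin m, ‖a i.succ‖ ^ 2 := Finset.sum_nonneg fun i _ => by positivity
    set S := ∑ i : Fin m, ‖a i.succ‖ ^ 2
    set A := ‖y‖
    set B := ‖a 0‖
    -- With `P + Q = 2 (A² + B²)` and `P, Q ≤ (A + B)²`, the maximum of `P² + Q²` is attained at
    -- the extreme point `P = (A + B)²`, `Q = (A - B)²`.
    have h4 : ‖y + a 0‖ ^ 2 ≤ (A + B) ^ 2 := by gcongr
    have h5 : ‖y - a 0‖ ^ 2 ≤ (A + B) ^ 2 := by gcongr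
    have h6 : ‖y + a 0‖ ^ 4 + ‖y - a 0‖ ^ 4 ≤ 2 * (A ^ 4 + 6 * A ^ 2 * B ^ 2 + B ^ 4) := by
      have h7 : ‖y + a 0‖ ^ 2 + ‖y - a 0‖ ^ 2 = 2 * (A ^ 2 + B ^ 2) := by linarith
      nlinarith [mul_nonneg (sub_nonneg.2 h4) (sub_nonneg.2 h5)]
    have h8 : (‖y + a 0‖ ^ 2 + ‖y - a 0‖ ^ 2) * S = 2 * (A ^ 2 + B ^ 2) * S := by
      linear_combination S * h1
    have h9 : 0 ≤ B ^ 4 := by positivity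
    nlinarith

/-- Khinchine's inequality between the first and second moments, with constant `2`. -/
lemma sqrt_sum_sq_le_lintegral_rademacher_sum {m : ℕ} (a : Fin m → 𝕜) :
    ENNReal.ofReal (√(∑ i, ‖a i‖ ^ 2))
      ≤ 2 * ∫⁻ t in Icc (0 : ℝ) 1, ‖∑ i : Fin m, (rademacher i t : 𝕜) • a i‖ₑ := by
  set S := ∑ i, ‖a i‖ ^ 2 with hS
  have hS0 : 0 ≤ S := Finset.sum_nonneg fun i _ => by positivity
  rcases hS0.eq_or_lt with h0 | hpos
  · simp [← h0]
  set s := √S with hs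
  have hspos : 0 < s := Real.sqrt_pos.2 hpos
  have hsS : s ^ 2 = S := Real.sq_sqrt hS0
  set T : ℝ → 𝕜 := fun t => ∑ i : Fin m, (rademacher i t : 𝕜) • a i with hT
  have hTm : Measurable fun t => ‖T t‖ₑ := (stronglyMeasurable_rademacher_sum a).enorm
  -- The tangent line inequality `12 s² x² ≤ 16 s³ x + x⁴`, with equality at `x = 2 s`.
  have hpt : ∀ t, ENNReal.ofReal (12 * s ^ 2) * ‖T t‖ₑ ^ 2
      ≤ ENNReal.ofReal (16 * s ^ 3) * ‖T t‖ₑ + ‖T t‖ₑ ^ 4 := by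
    intro t
    rw [← ofReal_norm, ← ENNReal.ofReal_pow (norm_nonneg _), ← ENNReal.ofReal_pow (norm_nonneg _),
      ← ENNReal.ofReal_mul (by positivity), ← ENNReal.ofReal_mul (by positivity),
      ← ENNReal.ofReal_add (by positivity) (by positivity)]
    refine ENNReal.ofReal_le_ofReal ?_
    have hx := norm_nonneg (T t)
    have : 0 ≤ ‖T t‖ * (‖T t‖ + 4 * s) * (‖T t‖ - 2 * s) ^ 2 := by positivity
    nlinarith
  have h2 := lintegral_rademacher_sum_sq (𝕜 := 𝕜) 0 a
  have h4 := lintegral_rademacher_sum_pow_four 0 a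
  simp only [zero_add, norm_zero, ne_eq, OfNat.ofNat_ne_zero, not_false_eq_true, zero_pow,
    mul_zero, zero_mul, ← hS] at h2 h4
  have hint := lintegral_mono (μ := volume.restrict (Icc (0 : ℝ) 1)) hpt
  rw [lintegral_const_mul _ (hTm.pow_const 2), lintegral_add_right _ (hTm.pow_const 4),
    lintegral_const_mul _ hTm, h2] at hint
  by_cases htop : ∫⁻ t in Icc (0 : ℝ) 1, ‖T t‖ₑ = ∞
  · rw [htop]
    simp
  lift (∫⁻ t in Icc (0 : ℝ) 1, ‖T t‖ₑ) to ℝ≥0 using htop with J hJ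
  replace hint := hint.trans (add_le_add_right h4 _)
  rw [← ENNReal.ofReal_coe_nnreal, ← ENNReal.ofReal_mul (by positivity),
    ← ENNReal.ofReal_mul (by positivity), ← ENNReal.ofReal_add (by positivity) (by positivity),
    ENNReal.ofReal_le_ofReal_iff (by positivity), ← hsS] at hint
  change ENNReal.ofReal s ≤ 2 * ∫⁻ t in Icc (0 : ℝ) 1, ‖T t‖ₑ
  rw [← hJ, ← ENNReal.ofReal_coe_nnreal, show (2 : ℝ≥0∞) = ENNReal.ofReal 2 by norm_num,
    ← ENNReal.ofReal_mul (by norm_num)]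
  refine ENNReal.ofReal_le_ofReal ?_
  have h3 : 0 < s ^ 3 := by positivity
  have hJ0 : (0 : ℝ) ≤ J := J.2
  have : s ^ 3 * (9 * s) ≤ s ^ 3 * (16 * J) := by nlinarith
  have := le_of_mul_le_mul_left this h3
  linarith

lemma lintegral_enorm_le_radNorm {E : Type*} [NormedAddCommGroup E] [NormedSpace 𝕜 E]
    {m : ℕ} (x : Fin m → E) :
    ∫⁻ t in Icc (0 : ℝ) 1, ‖∑ i : Fin m, (rademacher i t : 𝕜) • x i‖ₑ ≤ radNorm 𝕜 x := by
  have h := ENNReal.lintegral_mul_le_Lp_mul_Lq (volume.restrict (Icc (0 : ℝ) 1))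
    Real.HolderConjugate.two_two
    (stronglyMeasurable_rademacher_sum (𝕜 := 𝕜) x).enorm.aemeasurable
    (aemeasurable_const (b := (1 : ℝ≥0∞)))
  simpa [radNorm] using h

end RademacherSums

end SummingOperators

/-! ### Almost summing operators on Hilbert spaces -/

namespace SummingOperators

open MeasureTheory Set

lemma strongNorm_one {ι E : Type*} [NormedAddCommGroup E] (x : ι → E) :
    strongNorm 1 x = ∑' i, ‖x i‖ₑ := by
  simp [strongNorm]

lemma strongNorm_two_le_iff {ι E : Type*} [NormedAddCommGroup E] {x : ι → E} {c : ℝ≥0∞} :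
    strongNorm 2 x ≤ c ↔ ∑' i, ‖x i‖ₑ ^ 2 ≤ c ^ 2 := by
  have h : strongNorm 2 x = (∑' i, ‖x i‖ₑ ^ 2) ^ (1 / 2 : ℝ) := by simp [strongNorm]
  rw [h, one_div, ENNReal.rpow_inv_le_iff two_pos]
  norm_num

lemma strongNorm_le_mul {ι E F : Type*} [NormedAddCommGroup E] [NormedAddCommGroup F]
    {p : ℝ≥0∞} (hp : 1 ≤ p) {x : ι → E} {y : ι → F} {c : ℝ≥0∞}
    (h : ∀ i, ‖y i‖ₑ ≤ c * ‖x i‖ₑ) : strongNorm p y ≤ c * strongNorm p x := by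
  unfold strongNorm
  split_ifs with htop
  · rw [ENNReal.mul_iSup]
    exact iSup_mono h
  · have hp0 : 0 < p.toReal := ENNReal.toReal_pos (zero_lt_one.trans_le hp).ne' htop
    rw [one_div, ENNReal.rpow_inv_le_iff hp0, ENNReal.mul_rpow_of_nonneg _ _ hp0.le,
      ENNReal.rpow_inv_rpow hp0.ne', ← ENNReal.tsum_mul_left]
    refine ENNReal.tsum_le_tsum fun i => ?_
    rw [← ENNReal.mul_rpow_of_nonneg _ _ hp0.le]
    exact ENNReal.rpow_le_rpow (h i) hp0.le

/-- Hölder's inequality. -/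
lemma sum_enorm_mul_enorm_le {ι E F : Type*} [NormedAddCommGroup E] [NormedAddCommGroup F]
    {q : ℝ≥0∞} (hq : 1 < q) (s : Finset ι) (x : ι → E) (y : ι → F) :
    ∑ i ∈ s, ‖x i‖ₑ * ‖y i‖ₑ ≤ strongNorm q x * strongNorm q.conjExponent y := by
  rcases eq_or_ne q ∞ with rfl | htop
  · have h1 : (∞ : ℝ≥0∞).conjExponent = 1 := by simp [ENNReal.conjExponent]
    rw [h1, strongNorm_one]
    have h2 : strongNorm ∞ x = ⨆ i, ‖x i‖ₑ := by simp [strongNorm]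
    rw [h2]
    calc ∑ i ∈ s, ‖x i‖ₑ * ‖y i‖ₑ ≤ ∑ i ∈ s, (⨆ i, ‖x i‖ₑ) * ‖y i‖ₑ :=
          Finset.sum_le_sum fun i _ => mul_le_mul_left (le_iSup (fun i => ‖x i‖ₑ) i) _
      _ = (⨆ i, ‖x i‖ₑ) * ∑ i ∈ s, ‖y i‖ₑ := by rw [Finset.mul_sum]
      _ ≤ _ := mul_le_mul_right (ENNReal.sum_le_tsum s) _
  · have hc : q.HolderConjugate q.conjExponent := .conjExponent hq.le
    have hctop : q.conjExponent ≠ ∞ := by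
      simp [ENNReal.conjExponent, tsub_eq_zero_iff_le, hq]
    have hr := ENNReal.HolderConjugate.toReal_of_ne_top htop hctop
    refine (ENNReal.inner_le_Lp_mul_Lq s _ _ hr).trans ?_
    simp only [strongNorm, if_neg htop, if_neg hctop]
    have h1 := hr.one_div_nonneg
    have h2 := hr.symm.one_div_nonneg
    gcongr <;> exact ENNReal.sum_le_tsum s

variable {𝕜 : Type*} [RCLike 𝕜]

lemma strongNorm_le_weakNorm {ι E : Type*} [NormedAddCommGroup E] [NormedSpace 𝕜 E]
    (p : ℝ≥0∞) (x : ι → E) {φ : StrongDual 𝕜 E} (hφ : ‖φ‖ ≤ 1) :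
    strongNorm p (fun i => φ (x i)) ≤ weakNorm 𝕜 p x :=
  le_iSup₂_of_le (f := fun (φ : StrongDual 𝕜 E) (_ : ‖φ‖ ≤ 1) =>
    strongNorm p (fun i => φ (x i))) φ hφ le_rfl

lemma strongNorm_dual_le {ι E : Type*} [NormedAddCommGroup E] [NormedSpace 𝕜 E]
    {p : ℝ≥0∞} (hp : 1 ≤ p) (x : ι → E) (φ : StrongDual 𝕜 E) :
    strongNorm p (fun i => φ (x i)) ≤ ‖φ‖ₑ * weakNorm 𝕜 p x := by
  rcases eq_or_ne φ 0 with rfl | hφ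
  · refine (strongNorm_le_mul (c := 0) hp (x := fun i => x i) fun i => ?_).trans ?_ <;> simp
  have hne : ‖φ‖ ≠ 0 := norm_ne_zero_iff.2 hφ
  have henorm0 : ‖φ‖ₑ ≠ 0 := by
    rw [← ofReal_norm]
    exact (ENNReal.ofReal_pos.2 (norm_pos_iff.2 hφ)).ne'
  have henorm : ‖(‖φ‖ : 𝕜)‖ₑ = ‖φ‖ₑ := by
    rw [← ofReal_norm, RCLike.norm_ofReal, abs_norm, ofReal_norm]
  refine (strongNorm_le_mul (c := ‖φ‖ₑ)
    (x := fun i => (((‖φ‖ : 𝕜)⁻¹ • φ : StrongDual 𝕜 E)) (x i)) hp fun i => ?_).trans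
    (mul_le_mul_right (strongNorm_le_weakNorm p x ?_) _)
  · rw [smul_apply, enorm_smul, ← mul_assoc]
    rw [enorm_inv (by exact_mod_cast hne), henorm,
      ENNReal.mul_inv_cancel henorm0 enorm_ne_top, one_mul]
  · rw [norm_smul, norm_inv, RCLike.norm_ofReal, abs_norm, inv_mul_cancel₀ hne]

lemma strongNorm_apply_le {ι E : Type*} [NormedAddCommGroup E] [NormedSpace 𝕜 E]
    {p : ℝ≥0∞} (hp : 1 ≤ p) (φ : ι → StrongDual 𝕜 E) (y : E) :
    strongNorm p (fun i => φ i y) ≤ ‖y‖ₑ * weakNorm 𝕜 p φ := by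
  refine (strongNorm_dual_le hp φ (NormedSpace.inclusionInDoubleDual 𝕜 E y)).trans
    (mul_le_mul_left ?_ _)
  rw [enorm_le_iff_norm_le]
  exact NormedSpace.double_dual_bound 𝕜 E y

/-- Bessel's inequality. -/
lemma weakNorm_two_orthonormal_le {H X : Type*} [NormedAddCommGroup H] [InnerProductSpace 𝕜 H]
    [CompleteSpace H] [NormedAddCommGroup X] [NormedSpace 𝕜 X] (T : H →L[𝕜] X)
    {ι : Type*} [Fintype ι] {b : ι → H} (hb : Orthonormal 𝕜 b) :
    weakNorm 𝕜 2 (fun k => T (b k)) ≤ ‖T‖ₑ := by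
  refine iSup₂_le fun φ hφ => strongNorm_two_le_iff.2 ?_
  set v := (InnerProductSpace.toDual 𝕜 H).symm (φ ∘L T) with hv
  have hvn : ‖v‖ ≤ ‖T‖ := by
    rw [hv, LinearIsometryEquiv.norm_map]
    refine (ContinuousLinearMap.opNorm_comp_le _ _).trans ?_
    exact (mul_le_mul_of_nonneg_right hφ (norm_nonneg _)).trans_eq (one_mul _)
  have h1 : ∀ k, ‖φ (T (b k))‖ = ‖inner 𝕜 (b k) v‖ := fun k => by
    rw [norm_inner_symm, hv, InnerProductSpace.toDual_symm_apply]
    rfl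
  rw [tsum_fintype]
  simp only [← ofReal_norm, h1]
  simp only [← ENNReal.ofReal_pow (norm_nonneg _)]
  rw [← ENNReal.ofReal_sum_of_nonneg fun i _ => by positivity]
  refine ENNReal.ofReal_le_ofReal ((hb.sum_inner_products_le v).trans ?_)
  gcongr

/-- The quantitative form of the inclusion of almost summing operators in Cohen strongly
`q`-summing operators on a Hilbert space. The coordinates of the `x i` in a common orthonormal
basis `b` give `‖φ i (u (x i))‖ ≤ ‖x i‖ (∑ₖ |φ i (u (b k))|²) ^ (1 / 2)`, the second factor is at
most twice the mean of `|φ i (W t)|` with `W t = ∑ₖ r_k(t) u (b k)` by Khinchine, and for every `t`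
Hölder's inequality bounds the sum over `i`. -/
lemma sum_enorm_apply_le_of_hilbert {H Y : Type*} [NormedAddCommGroup H] [InnerProductSpace 𝕜 H]
    [NormedAddCommGroup Y] [NormedSpace 𝕜 Y] (u : H →L[𝕜] Y) {C : ℝ≥0∞}
    (hC : ∀ (N : ℕ) (b : Fin N → H), Orthonormal 𝕜 b → radNorm 𝕜 (fun k => u (b k)) ≤ C)
    {q : ℝ≥0∞} (hq : 1 < q) (x : ℕ → H) (φ : ℕ → StrongDual 𝕜 Y)
    (hφ : weakNorm 𝕜 q.conjExponent φ ≤ 1) (s : Finset ℕ) :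
    ∑ i ∈ s, ‖φ i (u (x i))‖ₑ ≤ 2 * (strongNorm q x * C) := by
  classical
  let S : Submodule 𝕜 H := Submodule.span 𝕜 (s.image x)
  have hxS : ∀ i ∈ s, x i ∈ S := fun i hi => Submodule.subset_span (by simp; exact ⟨i, hi, rfl⟩)
  let β := stdOrthonormalBasis 𝕜 S
  let b : Fin (Module.finrank 𝕜 S) → H := fun k => (β k : H)
  have hb : Orthonormal 𝕜 b := β.orthonormal.comp_linearIsometry S.subtypeₗᵢ
  set W : ℝ → Y := fun t => ∑ k : Fin (Module.finrank 𝕜 S), (rademacher k t : 𝕜) • u (b k) with hW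
  have hWm : StronglyMeasurable W := stronglyMeasurable_rademacher_sum _
  have hφW : ∀ i t, ∑ k : Fin (Module.finrank 𝕜 S), (rademacher k t : 𝕜) • φ i (u (b k))
      = φ i (W t) := fun i t => by simp [hW, map_sum]
  have hmeas : ∀ i, Measurable fun t => ‖φ i (W t)‖ₑ := fun i =>
    ((φ i).continuous.comp_stronglyMeasurable hWm).enorm
  have hterm : ∀ i ∈ s, ‖φ i (u (x i))‖ₑ
      ≤ 2 * ∫⁻ t in Icc (0 : ℝ) 1, ‖x i‖ₑ * ‖φ i (W t)‖ₑ := by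
    intro i hi
    have hexp : x i = ∑ k, β.repr ⟨x i, hxS i hi⟩ k • b k := by
      have := congrArg (Subtype.val) (β.sum_repr ⟨x i, hxS i hi⟩)
      simpa [b] using this.symm
    have hnorm : √(∑ k, ‖β.repr ⟨x i, hxS i hi⟩ k‖ ^ 2) = ‖x i‖ := by
      rw [← EuclideanSpace.norm_eq, LinearIsometryEquiv.norm_map]
      rfl
    have h1 : ‖φ i (u (x i))‖ ≤ ‖x i‖ * √(∑ k, ‖φ i (u (b k))‖ ^ 2) := by
      rw [← hnorm]
      refine le_trans ?_ (Real.sum_mul_le_sqrt_mul_sqrt _ _ _)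
      conv_lhs => rw [hexp]
      simp only [map_sum, map_smul, smul_eq_mul]
      exact (norm_sum_le _ _).trans_eq (by simp)
    have h2 := sqrt_sum_sq_le_lintegral_rademacher_sum (𝕜 := 𝕜) fun k => φ i (u (b k))
    simp only [hφW] at h2
    rw [lintegral_const_mul _ (hmeas i), mul_left_comm]
    refine le_trans ?_ (mul_le_mul_right h2 _)
    rw [← ofReal_norm, ← ofReal_norm, ← ENNReal.ofReal_mul (norm_nonneg _)]
    exact ENNReal.ofReal_le_ofReal h1
  have hpt : ∀ t, ∑ i ∈ s, ‖x i‖ₑ * ‖φ i (W t)‖ₑ ≤ strongNorm q x * ‖W t‖ₑ := by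
    intro t
    refine (sum_enorm_mul_enorm_le hq s x fun i => φ i (W t)).trans (mul_le_mul_right ?_ _)
    refine (strongNorm_apply_le (by simp [ENNReal.conjExponent]) φ (W t)).trans ?_
    exact (mul_le_mul_right hφ _).trans_eq (mul_one _)
  calc ∑ i ∈ s, ‖φ i (u (x i))‖ₑ
      ≤ ∑ i ∈ s, 2 * ∫⁻ t in Icc (0 : ℝ) 1, ‖x i‖ₑ * ‖φ i (W t)‖ₑ := Finset.sum_le_sum hterm
    _ = 2 * ∫⁻ t in Icc (0 : ℝ) 1, ∑ i ∈ s, ‖x i‖ₑ * ‖φ i (W t)‖ₑ := by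
        rw [← Finset.mul_sum, lintegral_finsetSum _ fun i _ => (hmeas i).const_mul _]
    _ ≤ 2 * ∫⁻ t in Icc (0 : ℝ) 1, strongNorm q x * ‖W t‖ₑ := by gcongr with t; exact hpt t
    _ = 2 * (strongNorm q x * ∫⁻ t in Icc (0 : ℝ) 1, ‖W t‖ₑ) := by
        rw [lintegral_const_mul _ hWm.enorm]
    _ ≤ 2 * (strongNorm q x * C) := by
        gcongr
        exact (lintegral_enorm_le_radNorm _).trans (hC _ b hb)

lemma almostSumming_subset_cohenStronglySumming {X : Type u} [NormedAddCommGroup X]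
    [NormedSpace 𝕜 X] (hX : IsIsomorphicToHilbert 𝕜 X) {q : ℝ≥0∞} (hq : 1 < q)
    (Y : Type v) [NormedAddCommGroup Y] [NormedSpace 𝕜 Y] :
    almostSumming 𝕜 X Y ⊆ cohenStronglySumming 𝕜 X Y q := by
  rintro u ⟨C, hC⟩ x hx
  obtain ⟨H, _, _, _, ⟨e⟩⟩ := hX
  have key := sum_enorm_apply_le_of_hilbert (u ∘L (e.symm : H →L[𝕜] X))
    (C := C * ‖(e.symm : H →L[𝕜] X)‖ₑ)
    (fun N b hb => (hC N fun k => e.symm (b k)).trans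
      (mul_le_mul_right (weakNorm_two_orthonormal_le (e.symm : H →L[𝕜] X) hb) _)) hq
    (fun i => e (x i))
  have hex : strongNorm q (fun i => e (x i)) ≤ ‖(e : X →L[𝕜] H)‖ₑ * strongNorm q x :=
    strongNorm_le_mul hq.le fun i => (e : X →L[𝕜] H).le_opENorm (x i)
  have hfin : 2 * (strongNorm q (fun i => e (x i)) * (C * ‖(e.symm : H →L[𝕜] X)‖ₑ)) < ∞ := by
    refine ENNReal.mul_lt_top (by simp) (ENNReal.mul_lt_top (hex.trans_lt ?_) ?_)
    · exact ENNReal.mul_lt_top enorm_lt_top hx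
    · exact ENNReal.mul_lt_top ENNReal.coe_lt_top enorm_lt_top
  refine lt_of_le_of_lt (iSup₂_le fun φ hφ => ?_) hfin
  rw [strongNorm_one, ENNReal.tsum_eq_iSup_sum]
  refine iSup_le fun s => ?_
  simpa using key φ hφ s

end SummingOperators

/-! ### A uniform trace estimate -/

namespace SummingOperators

open MeasureTheory Set

lemma sum_enorm_sq {ι E : Type*} [NormedAddCommGroup E] (s : Finset ι) (x : ι → E) :
    ∑ i ∈ s, ‖x i‖ₑ ^ 2 = ENNReal.ofReal (∑ i ∈ s, ‖x i‖ ^ 2) := by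
  rw [ENNReal.ofReal_sum_of_nonneg fun i _ => by positivity]
  simp only [← ofReal_norm, ENNReal.ofReal_pow (norm_nonneg _)]

lemma sum_enorm_sq_euclideanSpace {𝕜 ι : Type*} [RCLike 𝕜] [Fintype ι]
    (y : EuclideanSpace 𝕜 ι) : ∑ k, ‖y k‖ₑ ^ 2 = ‖y‖ₑ ^ 2 := by
  rw [sum_enorm_sq, ← EuclideanSpace.norm_sq_eq, ← ofReal_norm,
    ENNReal.ofReal_pow (norm_nonneg _)]

lemma enorm_sq_lp {E : ℕ → Type*} [∀ N, NormedAddCommGroup (E N)] (f : lp E 2) :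
    ‖f‖ₑ ^ 2 = ∑' N, ‖f N‖ₑ ^ 2 := by
  have h := lp.hasSum_norm (p := 2) (by norm_num) f
  simp only [ENNReal.toReal_ofNat, Real.rpow_ofNat] at h
  rw [← ofReal_norm, ← ENNReal.ofReal_pow (norm_nonneg _), ← h.tsum_eq,
    ENNReal.ofReal_tsum_of_nonneg (fun N => by positivity) h.summable]
  simp only [← ofReal_norm, ENNReal.ofReal_pow (norm_nonneg _)]

lemma tsum_quarter_pow_le : ∑' N : ℕ, ENNReal.ofReal ((1 / 4) ^ N) ≤ 2 ^ 2 := by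
  rw [← ENNReal.ofReal_tsum_of_nonneg (fun N => by positivity)
    (summable_geometric_of_lt_one (by norm_num) (by norm_num)),
    tsum_geometric_of_lt_one (by norm_num) (by norm_num),
    show (2 : ℝ≥0∞) ^ 2 = ENNReal.ofReal 4 by norm_num]
  exact ENNReal.ofReal_le_ofReal (by norm_num)

variable {𝕜 : Type w} [RCLike 𝕜]

lemma weakNorm_two_le_one {ι : Type*} {Y : Type*} [NormedAddCommGroup Y] [NormedSpace 𝕜 Y]
    (φ : ι → StrongDual 𝕜 Y) (h : ∀ y, ∑' i, ‖φ i y‖ₑ ^ 2 ≤ ‖y‖ₑ ^ 2) :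
    weakNorm 𝕜 2 φ ≤ 1 := by
  refine iSup₂_le fun Φ hΦ => strongNorm_two_le_iff.2 ?_
  rw [ENNReal.tsum_eq_iSup_sum]
  refine iSup_le fun s => ?_
  rw [sum_enorm_sq]
  set S := ∑ i ∈ s, ‖Φ (φ i)‖ ^ 2 with hS
  have hS0 : 0 ≤ S := Finset.sum_nonneg fun i _ => by positivity
  -- Testing `Φ` on the combination of the `φ i` with coefficients `conj (Φ (φ i))` gives `S`.
  set ψ : StrongDual 𝕜 Y := ∑ i ∈ s, (starRingEnd 𝕜) (Φ (φ i)) • φ i with hψ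
  have h1 : ‖ψ‖ ≤ √S := by
    refine ContinuousLinearMap.opNorm_le_bound _ (Real.sqrt_nonneg _) fun y => ?_
    have hy : ∑ i ∈ s, ‖φ i y‖ ^ 2 ≤ ‖y‖ ^ 2 := by
      have := (ENNReal.sum_le_tsum s).trans (h y)
      rwa [sum_enorm_sq, ← ofReal_norm, ← ENNReal.ofReal_pow (norm_nonneg _),
        ENNReal.ofReal_le_ofReal_iff (by positivity)] at this
    have h3 : ψ y = ∑ i ∈ s, (starRingEnd 𝕜) (Φ (φ i)) * φ i y := by simp [hψ]
    rw [h3]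
    calc ‖∑ i ∈ s, (starRingEnd 𝕜) (Φ (φ i)) * φ i y‖
        ≤ ∑ i ∈ s, ‖Φ (φ i)‖ * ‖φ i y‖ := (norm_sum_le _ _).trans_eq (by simp)
      _ ≤ √S * √(∑ i ∈ s, ‖φ i y‖ ^ 2) := Real.sum_mul_le_sqrt_mul_sqrt _ _ _
      _ ≤ √S * ‖y‖ := by
          gcongr
          exact Real.sqrt_le_iff.2 ⟨norm_nonneg _, hy⟩
  have h2 : Φ ψ = (S : 𝕜) := by
    simp [hψ, hS, map_sum, RCLike.conj_mul]
  have h3 : S ≤ √S := by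
    calc S = ‖Φ ψ‖ := by rw [h2, RCLike.norm_ofReal, abs_of_nonneg hS0]
      _ ≤ ‖Φ‖ * ‖ψ‖ := Φ.le_opNorm _
      _ ≤ 1 * √S := by gcongr
      _ = √S := one_mul _
  have h4 : S ≤ 1 := by
    have h5 := Real.mul_self_sqrt hS0
    by_contra hlt
    have h6 : 1 < √S := Real.lt_sqrt_of_sq_lt (by linarith)
    nlinarith
  simpa using h4

/-- The `ℓ²`-sum of operators with geometrically decreasing norms. -/
lemma exists_l2_sum {X : Type*} [NormedAddCommGroup X] [NormedSpace 𝕜 X] {E : ℕ → Type*}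
    [∀ N, NormedAddCommGroup (E N)] [∀ N, NormedSpace 𝕜 (E N)] (v : ∀ N, X →L[𝕜] E N)
    (hv : ∀ N x, ‖v N x‖ ^ 2 ≤ (1 / 4) ^ N * ‖x‖ ^ 2) :
    ∃ T : X →L[𝕜] lp E 2, ∀ x N, T x N = v N x := by
  have hmem : ∀ x, Memℓp (fun N => v N x) 2 := fun x => by
    refine memℓp_gen (Summable.of_nonneg_of_le (fun N => by positivity) (fun N => ?_)
      ((summable_geometric_of_lt_one (r := (1 / 4 : ℝ)) (by norm_num) (by norm_num)).mul_right
        (‖x‖ ^ 2)))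
    simpa using hv N x
  let T : X →ₗ[𝕜] lp E 2 :=
    { toFun := fun x => ⟨fun N => v N x, hmem x⟩
      map_add' := fun x y => by
        ext N
        exact map_add (v N) x y
      map_smul' := fun c x => by
        ext N
        exact map_smul (v N) c x }
  refine ⟨T.mkContinuous 2 fun x => ?_, fun x N => rfl⟩
  have h1 : ‖T x‖ₑ ^ 2 ≤ (2 * ‖x‖ₑ) ^ 2 := by
    rw [enorm_sq_lp, mul_pow]
    refine le_trans ?_ (mul_le_mul_left tsum_quarter_pow_le _)
    rw [← ENNReal.tsum_mul_right]
    refine ENNReal.tsum_le_tsum fun N => ?_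
    rw [← ofReal_norm, ← ofReal_norm, ← ENNReal.ofReal_pow (norm_nonneg _),
      ← ENNReal.ofReal_pow (norm_nonneg _), ← ENNReal.ofReal_mul (by positivity)]
    exact ENNReal.ofReal_le_ofReal (hv N x)
  have h2 : 2 * ‖x‖ₑ = ENNReal.ofReal (2 * ‖x‖) := by
    rw [ENNReal.ofReal_mul (by norm_num), ofReal_norm, ENNReal.ofReal_ofNat]
  rw [h2, ← ofReal_norm, ← ENNReal.ofReal_pow (norm_nonneg _),
    ← ENNReal.ofReal_pow (by positivity), ENNReal.ofReal_le_ofReal_iff (by positivity)] at h1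
  exact le_of_sq_le_sq h1 (by positivity)

lemma small_rclike (𝕜 : Type w) [RCLike 𝕜] : Small.{v} 𝕜 :=
  small_of_injective (β := ℝ × ℝ) (f := fun z : 𝕜 => (RCLike.re z, RCLike.im z)) fun z z' h => by
    simp only [Prod.mk.injEq] at h
    exact RCLike.ext h.1 h.2

/-- An operator dominated by a sequence `g` of functionals with square summable norms (hence a
`2`-summing operator) is almost summing if its values lie in a Hilbert space. -/
lemma radNorm_le_of_le_tsum {X : Type u} [NormedAddCommGroup X] [NormedSpace 𝕜 X]
    {H : Type*} [NormedAddCommGroup H] [InnerProductSpace 𝕜 H] (T : X →L[𝕜] H)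
    {ι : Type*} (g : ι → StrongDual 𝕜 X) (hT : ∀ x, ‖T x‖ₑ ^ 2 ≤ ∑' j, ‖g j x‖ₑ ^ 2)
    {C : ℝ≥0∞} (hg : ∑' j, ‖g j‖ₑ ^ 2 ≤ C ^ 2) {m : ℕ} (x : Fin m → X) :
    radNorm 𝕜 (fun i => T (x i)) ≤ C * weakNorm 𝕜 2 x := by
  have h := lintegral_rademacher_sum_sq (𝕜 := 𝕜) 0 fun i => T (x i)
  simp only [zero_add, norm_zero, ne_eq, OfNat.ofNat_ne_zero, not_false_eq_true, zero_pow] at h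
  rw [radNorm, h, one_div, ENNReal.rpow_inv_le_iff two_pos, ← sum_enorm_sq]
  norm_num only [ENNReal.rpow_ofNat]
  calc ∑ i, ‖T (x i)‖ₑ ^ 2 ≤ ∑ i, ∑' j, ‖g j (x i)‖ₑ ^ 2 := Finset.sum_le_sum fun i _ => hT _
    _ = ∑' j, ∑' i, ‖g j (x i)‖ₑ ^ 2 := by
        rw [← tsum_fintype (L := .unconditional _), ENNReal.tsum_comm]
    _ ≤ ∑' j, (‖g j‖ₑ * weakNorm 𝕜 2 x) ^ 2 := ENNReal.tsum_le_tsum fun j =>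
        strongNorm_two_le_iff.1 (strongNorm_dual_le (by norm_num) x (g j))
    _ = (∑' j, ‖g j‖ₑ ^ 2) * weakNorm 𝕜 2 x ^ 2 := by
        simp only [mul_pow, ENNReal.tsum_mul_right]
    _ ≤ C ^ 2 * weakNorm 𝕜 2 x ^ 2 := by gcongr
    _ = (C * weakNorm 𝕜 2 x) ^ 2 := (mul_pow _ _ _).symm

/-- A uniform trace estimate for finite rank operators. If it failed, the `ℓ²`-sum of a sequence of
counterexamples with geometrically decreasing bounds would be almost summing, while the
concatenation of the corresponding tuples `z` would be a strongly `2`-summable sequence that,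
paired with the coordinate functionals, contradicts Cohen strong `2`-summability. The target is a
separable Hilbert space, so it has a copy in any universe. -/
lemma exists_trace_bound {X : Type u} [NormedAddCommGroup X] [NormedSpace 𝕜 X]
    (h : ∀ (Y : Type v) [NormedAddCommGroup Y] [NormedSpace 𝕜 Y] [CompleteSpace Y],
      almostSumming 𝕜 X Y ⊆ cohenStronglySumming 𝕜 X Y 2) :
    ∃ δ : ℝ, 0 < δ ∧ ∀ (n m : ℕ) (v : X →L[𝕜] EuclideanSpace 𝕜 (Fin n))
      (g : Fin m → StrongDual 𝕜 X) (z : Fin n → X), (∀ x, ‖v x‖ ^ 2 ≤ ∑ j, ‖g j x‖ ^ 2) →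
      ∑ j, ‖g j‖ ^ 2 ≤ δ ^ 2 → ∑ k, ‖z k‖ ^ 2 ≤ δ ^ 2 → ∑ k, ‖v (z k) k‖ < 1 := by
  by_contra! hneg
  choose n m v g z hv hg hz htr using fun N : ℕ => hneg ((1 / 2) ^ N) (by positivity)
  have hq : ∀ N : ℕ, (((1 : ℝ) / 2) ^ N) ^ 2 = (1 / 4) ^ N := fun N => by
    rw [← pow_mul, mul_comm, pow_mul]
    norm_num
  simp only [hq] at hg hz
  let E : ℕ → Type w := fun N => EuclideanSpace 𝕜 (Fin (n N))
  have hvb : ∀ N x, ‖v N x‖ ^ 2 ≤ (1 / 4) ^ N * ‖x‖ ^ 2 := fun N x => by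
    refine (hv N x).trans (le_trans ?_ (mul_le_mul_of_nonneg_right (hg N) (by positivity)))
    rw [Finset.sum_mul]
    refine Finset.sum_le_sum fun j _ => ?_
    rw [← mul_pow]
    gcongr
    exact (g N j).le_opNorm x
  obtain ⟨T, hT⟩ := exists_l2_sum (E := E) v hvb
  have hsmall : Small.{v} (lp E 2) := by
    have := small_rclike.{w, v} 𝕜
    exact small_of_injective (β := (Σ N, Fin (n N)) → Shrink.{v} 𝕜)
      (f := fun f p => equivShrink 𝕜 (f p.1 p.2)) fun f f' hff => by
        ext N k
        exact (equivShrink 𝕜).injective (congrFun hff ⟨N, k⟩)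
  let e : Shrink.{v} (lp E 2) ≃ₗᵢ[𝕜] lp E 2 :=
    { Shrink.linearEquiv 𝕜 (lp E 2) with norm_map' := fun _ => rfl }
  have hcomplete : CompleteSpace (Shrink.{v} (lp E 2)) :=
    (completeSpace_congr (e := e.toLinearEquiv.toEquiv) e.isometry.isUniformEmbedding).2 inferInstance
  let u : X →L[𝕜] Shrink.{v} (lp E 2) := (e.symm : lp E 2 →L[𝕜] Shrink.{v} (lp E 2)) ∘L T
  have hu : u ∈ almostSumming 𝕜 X (Shrink.{v} (lp E 2)) := by
    refine ⟨2, fun N x => ?_⟩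
    have h1 : radNorm 𝕜 (fun i => u (x i)) = radNorm 𝕜 (fun i => T (x i)) := by
      unfold radNorm
      congr 1
      refine lintegral_congr fun t => ?_
      congr 1
      have h2 : ∑ i : Fin N, (rademacher i t : 𝕜) • u (x i)
          = e.symm (∑ i : Fin N, (rademacher i t : 𝕜) • T (x i)) := by
        rw [map_sum]
        exact Finset.sum_congr rfl fun i _ => (map_smul e.symm _ _).symm
      rw [h2, e.symm.enorm_map]
    rw [h1, ENNReal.coe_ofNat]
    refine radNorm_le_of_le_tsum T (fun p : Σ N, Fin (m N) => g p.1 p.2) (fun y => ?_) ?_ x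
    · rw [enorm_sq_lp, ENNReal.tsum_sigma']
      refine ENNReal.tsum_le_tsum fun N => ?_
      rw [tsum_fintype, sum_enorm_sq, hT, ← ofReal_norm, ← ENNReal.ofReal_pow (norm_nonneg _)]
      exact ENNReal.ofReal_le_ofReal (hv N y)
    · rw [ENNReal.tsum_sigma']
      refine (ENNReal.tsum_le_tsum fun N => ?_).trans tsum_quarter_pow_le
      rw [tsum_fintype, sum_enorm_sq]
      exact ENNReal.ofReal_le_ofReal (hg N)
  have hne : ∀ N, Nonempty (Fin (n N)) := fun N => by
    by_contra hempty
    rw [not_nonempty_iff] at hempty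
    have := htr N
    rw [Fintype.sum_empty] at this
    linarith
  have hinf : Infinite (Σ N, Fin (n N)) :=
    Infinite.of_injective (fun N => (⟨N, (hne N).some⟩ : Σ N, Fin (n N))) fun a b hab =>
      congrArg Sigma.fst hab
  obtain ⟨σ⟩ : Nonempty (ℕ ≃ Σ N, Fin (n N)) := nonempty_equiv_of_countable
  let φ : ℕ → StrongDual 𝕜 (Shrink.{v} (lp E 2)) := fun i =>
    EuclideanSpace.proj (𝕜 := 𝕜) (σ i).2 ∘L lp.evalCLM 𝕜 E 2 (σ i).1 ∘L
      (e : Shrink.{v} (lp E 2) →L[𝕜] lp E 2)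
  have hφ : weakNorm 𝕜 (2 : ℝ≥0∞).conjExponent φ ≤ 1 := by
    have h2 : (2 : ℝ≥0∞).conjExponent = 2 := by
      rw [ENNReal.conjExponent, ← one_add_one_eq_two,
        ENNReal.add_sub_cancel_right ENNReal.one_ne_top, inv_one]
    rw [h2]
    refine weakNorm_two_le_one φ fun y => le_of_eq ?_
    calc ∑' i, ‖φ i y‖ₑ ^ 2 = ∑' p : Σ N, Fin (n N), ‖(e y) p.1 p.2‖ₑ ^ 2 :=
          σ.tsum_eq fun p => ‖(e y) p.1 p.2‖ₑ ^ 2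
      _ = ∑' N, ‖(e y) N‖ₑ ^ 2 := by
          rw [ENNReal.tsum_sigma']
          refine tsum_congr fun N => ?_
          rw [tsum_fintype]
          exact sum_enorm_sq_euclideanSpace ((e y) N)
      _ = ‖y‖ₑ ^ 2 := by rw [← enorm_sq_lp, e.enorm_map]
  have hx : strongNorm 2 (fun i => z (σ i).1 (σ i).2) < ∞ := by
    refine lt_of_le_of_lt (b := 2) (strongNorm_two_le_iff.2 ?_) (by norm_num)
    rw [σ.tsum_eq fun p => ‖z p.1 p.2‖ₑ ^ 2, ENNReal.tsum_sigma']
    refine (ENNReal.tsum_le_tsum fun N => ?_).trans tsum_quarter_pow_le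
    rw [tsum_fintype, sum_enorm_sq]
    exact ENNReal.ofReal_le_ofReal (hz N)
  have hfin := h _ hu _ hx
  have hle : strongNorm 1 (fun i => φ i (u (z (σ i).1 (σ i).2))) < ∞ :=
    lt_of_le_of_lt (le_iSup₂_of_le (f := fun (φ : ℕ → StrongDual 𝕜 (Shrink.{v} (lp E 2)))
      (_ : weakNorm 𝕜 (2 : ℝ≥0∞).conjExponent φ ≤ 1) =>
        strongNorm 1 (fun i => φ i (u (z (σ i).1 (σ i).2)))) φ hφ le_rfl) hfin
  have hval : ∀ i, φ i (u (z (σ i).1 (σ i).2)) = v (σ i).1 (z (σ i).1 (σ i).2) (σ i).2 :=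
    fun i => by
      have : e (u (z (σ i).1 (σ i).2)) = T (z (σ i).1 (σ i).2) := e.apply_symm_apply _
      change (e (u (z (σ i).1 (σ i).2))) (σ i).1 (σ i).2 = _
      rw [this, hT]
  rw [strongNorm_one] at hle
  simp only [hval] at hle
  rw [σ.tsum_eq fun p => ‖v p.1 (z p.1 p.2) p.2‖ₑ, ENNReal.tsum_sigma'] at hle
  refine hle.ne (top_le_iff.1 ?_)
  rw [← ENNReal.tsum_const_eq_top_of_ne_zero (α := ℕ) (one_ne_zero (α := ℝ≥0∞))]
  refine ENNReal.tsum_le_tsum fun N => ?_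
  rw [tsum_fintype]
  simp only [← ofReal_norm]
  rw [← ENNReal.ofReal_sum_of_nonneg fun i _ => norm_nonneg _]
  simpa using htr N

end SummingOperators

/-! ### Tuples defining the same quadratic form -/

namespace SummingOperators

variable {𝕜 : Type w} [RCLike 𝕜] {X : Type u} [NormedAddCommGroup X] [NormedSpace 𝕜 X]

lemma exists_section_range {K V W : Type*} [Field K] [AddCommGroup V] [Module K V]
    [AddCommGroup W] [Module K W] (F : V →ₗ[K] W) :
    ∃ r : LinearMap.range F →ₗ[K] V, ∀ w, F (r w) = w := by
  obtain ⟨r, hr⟩ := F.rangeRestrict.exists_rightInverse_of_surjective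
    (LinearMap.range_rangeRestrict _)
  exact ⟨r, fun w => congrArg Subtype.val (LinearMap.congr_fun hr w)⟩

/-- If `∑ⱼ |f (xⱼ)|² = ∑ₖ |f (zₖ)|²` for all functionals `f`, then `x` is the image of `z` under a
matrix `a` with operator norm at most `1`; the norm bound is stated for the transpose of `a`. -/
lemma exists_contraction_matrix {n m : ℕ} (x : Fin m → X) (z : Fin n → X)
    (h : ∀ f : StrongDual 𝕜 X, ∑ j, ‖f (x j)‖ ^ 2 = ∑ k, ‖f (z k)‖ ^ 2) :
    ∃ a : Fin m → Fin n → 𝕜, (∀ (f : StrongDual 𝕜 X) j, f (x j) = ∑ k, a j k * f (z k)) ∧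
      ∀ c : Fin m → 𝕜, ∑ k, ‖∑ j, a j k * c j‖ ^ 2 ≤ ∑ j, ‖c j‖ ^ 2 := by
  -- `f ↦ (f (zₖ))ₖ` and `f ↦ (f (xⱼ))ⱼ` have equal norms, so the second map factors through the
  -- range of the first.
  let ev : ∀ {p : ℕ}, (Fin p → X) → StrongDual 𝕜 X →ₗ[𝕜] EuclideanSpace 𝕜 (Fin p) := fun y =>
    { toFun := fun f => WithLp.toLp 2 fun k => f (y k)
      map_add' := fun f g => rfl
      map_smul' := fun c f => rfl }
  have hnorm : ∀ f, ‖ev x f‖ = ‖ev z f‖ := fun f => by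
    rw [EuclideanSpace.norm_eq, EuclideanSpace.norm_eq]
    exact congrArg Real.sqrt (h f)
  obtain ⟨r, hr'⟩ := exists_section_range (ev z)
  let S := LinearMap.range (ev z)
  let A : EuclideanSpace 𝕜 (Fin n) →ₗ[𝕜] EuclideanSpace 𝕜 (Fin m) :=
    ev x ∘ₗ r ∘ₗ (S.orthogonalProjectionOnto : EuclideanSpace 𝕜 (Fin n) →ₗ[𝕜] S)
  have hA : ∀ f, A (ev z f) = ev x f := fun f => by
    have h1 : S.orthogonalProjectionOnto (ev z f) = ⟨ev z f, f, rfl⟩ :=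
      Submodule.orthogonalProjectionOnto_mem_subspace_eq_self (K := S) ⟨ev z f, f, rfl⟩
    have h2 : ‖ev x (r ⟨ev z f, f, rfl⟩ - f)‖ = 0 := by
      rw [hnorm, map_sub, hr', sub_self, norm_zero]
    rw [norm_eq_zero, map_sub, sub_eq_zero] at h2
    rw [← h2, ← h1]
    rfl
  have hAn : ∀ w, ‖A w‖ ≤ ‖w‖ := fun w => by
    change ‖ev x (r (S.orthogonalProjectionOnto w))‖ ≤ _
    rw [hnorm, hr']
    exact S.norm_orthogonalProjectionOnto_apply_le w
  let a : Fin m → Fin n → 𝕜 := fun j k => A (EuclideanSpace.single k 1) j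
  have ha : ∀ w j, A w j = ∑ k, a j k * w k := fun w j => by
    have hw : w = ∑ k, w k • EuclideanSpace.single k (1 : 𝕜) := by
      ext i
      simp [Finset.sum_apply, Pi.single_apply]
    conv_lhs => rw [hw]
    simp [map_sum, a, mul_comm]
  refine ⟨a, fun f j => ?_, fun c => ?_⟩
  · have h1 := ha (ev z f) j
    rwa [hA] at h1
  · -- Duality: with `d` the conjugate of the transposed image of `c`, the left side is the pairing
    -- of `c` with `A d`.
    set d : EuclideanSpace 𝕜 (Fin n) :=
      WithLp.toLp 2 fun k => (starRingEnd 𝕜) (∑ j, a j k * c j) with hd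
    have hdn : ‖d‖ ^ 2 = ∑ k, ‖∑ j, a j k * c j‖ ^ 2 := by
      rw [EuclideanSpace.norm_sq_eq]
      exact Finset.sum_congr rfl fun k _ => congrArg (· ^ 2) (RCLike.norm_conj _)
    have hpair : ((‖d‖ ^ 2 : ℝ) : 𝕜) = ∑ j, c j * A d j := by
      rw [hdn]
      simp only [ha, Finset.mul_sum]
      rw [Finset.sum_comm, RCLike.ofReal_sum]
      refine Finset.sum_congr rfl fun k _ => ?_
      rw [RCLike.ofReal_pow, ← RCLike.mul_conj, Finset.sum_mul]
      refine Finset.sum_congr rfl fun j _ => ?_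
      simp only [hd]
      ring
    have h1 : ‖d‖ ^ 2 ≤ √(∑ j, ‖c j‖ ^ 2) * ‖d‖ := by
      calc ‖d‖ ^ 2 = ‖∑ j, c j * A d j‖ := by
            rw [← hpair, RCLike.norm_ofReal, abs_of_nonneg (by positivity)]
        _ ≤ ∑ j, ‖c j‖ * ‖A d j‖ := (norm_sum_le _ _).trans_eq (by simp)
        _ ≤ √(∑ j, ‖c j‖ ^ 2) * √(∑ j, ‖A d j‖ ^ 2) := Real.sum_mul_le_sqrt_mul_sqrt _ _ _
        _ ≤ √(∑ j, ‖c j‖ ^ 2) * ‖d‖ := by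
            gcongr
            exact (EuclideanSpace.norm_eq (A d)).symm.trans_le (hAn d)
    rw [← hdn]
    have hc0 : 0 ≤ ∑ j, ‖c j‖ ^ 2 := Finset.sum_nonneg fun j _ => by positivity
    have h2 := Real.mul_self_sqrt hc0
    have h3 := norm_nonneg d
    have h4 : ‖d‖ ≤ √(∑ j, ‖c j‖ ^ 2) := by
      rcases h3.eq_or_lt with h0 | h0
      · rw [← h0]
        positivity
      · exact le_of_mul_le_mul_right (by rwa [← sq]) h0
    nlinarith

/-- From the trace estimate to a norm inequality between tuples with the same quadratic form
`f ↦ ∑ |f (xⱼ)|²`. The trace estimate is applied to the operator `y ↦ aᵀ (‖xⱼ‖ fⱼ(y))ⱼ`, with `fⱼ`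
norming `xⱼ` and `x = a z`: its trace against `z` is `∑ ‖xⱼ‖²`. -/
lemma exists_sum_norm_sq_le {δ : ℝ} (hδ : 0 < δ)
    (htr : ∀ (n m : ℕ) (v : X →L[𝕜] EuclideanSpace 𝕜 (Fin n))
      (g : Fin m → StrongDual 𝕜 X) (z : Fin n → X), (∀ x, ‖v x‖ ^ 2 ≤ ∑ j, ‖g j x‖ ^ 2) →
      ∑ j, ‖g j‖ ^ 2 ≤ δ ^ 2 → ∑ k, ‖z k‖ ^ 2 ≤ δ ^ 2 → ∑ k, ‖v (z k) k‖ < 1)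
    {n m : ℕ} (x : Fin m → X) (z : Fin n → X)
    (h : ∀ f : StrongDual 𝕜 X, ∑ j, ‖f (x j)‖ ^ 2 = ∑ k, ‖f (z k)‖ ^ 2) :
    δ ^ 4 * ∑ j, ‖x j‖ ^ 2 ≤ ∑ k, ‖z k‖ ^ 2 := by
  obtain ⟨a, hax, ha⟩ := exists_contraction_matrix x z h
  choose f hf hfx using fun j => exists_dual_vector'' 𝕜 (x j)
  set S := ∑ j, ‖x j‖ ^ 2 with hS
  set Z := ∑ k, ‖z k‖ ^ 2 with hZ
  have hS0 : 0 ≤ S := Finset.sum_nonneg fun j _ => by positivity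
  have hZ0 : 0 ≤ Z := Finset.sum_nonneg fun j _ => by positivity
  rcases hS0.eq_or_lt with hS1 | hSpos
  · rw [← hS1, mul_zero]
    exact hZ0
  have hZpos : 0 < Z := by
    refine hZ0.lt_of_ne fun hZ1 => hSpos.ne ?_
    have hz : ∀ k, z k = 0 := fun k => by
      have := (Finset.sum_eq_zero_iff_of_nonneg fun k _ => by positivity).1 hZ1.symm k
        (Finset.mem_univ k)
      simpa using this
    rw [hS, Finset.sum_eq_zero]
    intro j _
    have h1 : (‖x j‖ : 𝕜) = 0 := by
      rw [← hfx, hax]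
      simp [hz]
    have h2 : ‖x j‖ = 0 := by exact_mod_cast h1
    rw [h2]
    norm_num
  set s := √S
  set t := √Z
  have hs : 0 < s := Real.sqrt_pos.2 hSpos
  have ht : 0 < t := Real.sqrt_pos.2 hZpos
  have hsS : s ^ 2 = S := Real.sq_sqrt hS0
  have htZ : t ^ 2 = Z := Real.sq_sqrt hZ0
  let g : Fin m → StrongDual 𝕜 X := fun j => ((δ / s * ‖x j‖ : ℝ) : 𝕜) • f j
  let v : X →L[𝕜] EuclideanSpace 𝕜 (Fin n) :=
    ((EuclideanSpace.equiv (Fin n) 𝕜).symm : (Fin n → 𝕜) →L[𝕜] EuclideanSpace 𝕜 (Fin n)) ∘L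
      ContinuousLinearMap.pi fun k => ∑ j, a j k • g j
  have hv : ∀ y k, v y k = ∑ j, a j k * g j y := fun y k => by
    change (∑ j, a j k • g j) y = _
    simp
  have key := htr n m v g (fun k => ((δ / t : ℝ) : 𝕜) • z k) (fun y => ?_) ?_ ?_
  · have h1 : ∑ k, v (((δ / t : ℝ) : 𝕜) • z k) k = ((δ / t * (δ / s) * S : ℝ) : 𝕜) := by
      simp only [map_smul, PiLp.smul_apply, smul_eq_mul, hv, Finset.mul_sum]
      rw [Finset.sum_comm, hS, Finset.mul_sum, RCLike.ofReal_sum]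
      refine Finset.sum_congr rfl fun j _ => ?_
      have h2 : g j (x j) = ((δ / s * ‖x j‖ ^ 2 : ℝ) : 𝕜) := by
        simp only [g, smul_apply, smul_eq_mul, hfx]
        push_cast
        ring
      calc ∑ k, ((δ / t : ℝ) : 𝕜) * (a j k * g j (z k))
          = ((δ / t : ℝ) : 𝕜) * ∑ k, a j k * g j (z k) := (Finset.mul_sum _ _ _).symm
        _ = ((δ / t : ℝ) : 𝕜) * g j (x j) := by rw [hax]
        _ = _ := by
            rw [h2]
            push_cast
            ring
    have h3 : δ / t * (δ / s) * S < 1 := by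
      refine lt_of_le_of_lt ?_ key
      refine le_trans ?_ (norm_sum_le _ _)
      rw [h1, RCLike.norm_ofReal]
      exact le_abs_self _
    have h4 : δ / t * (δ / s) * S = δ ^ 2 * s / t := by
      rw [← hsS]
      field_simp
    rw [h4, div_lt_one ht] at h3
    have h5 : (δ ^ 2 * s) ^ 2 ≤ t ^ 2 := by gcongr
    rw [← hsS, ← htZ]
    linarith
  · rw [EuclideanSpace.norm_sq_eq]
    simp only [hv]
    exact ha fun j => g j y
  · calc ∑ j, ‖g j‖ ^ 2 ≤ ∑ j, (δ / s) ^ 2 * ‖x j‖ ^ 2 := by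
          refine Finset.sum_le_sum fun j _ => ?_
          rw [← mul_pow]
          have h0 : 0 ≤ δ / s * ‖x j‖ := by positivity
          have : ‖g j‖ ≤ δ / s * ‖x j‖ := by
            rw [norm_smul, RCLike.norm_ofReal, abs_of_nonneg h0]
            exact mul_le_of_le_one_right h0 (hf j)
          gcongr
      _ = δ ^ 2 := by
          rw [← Finset.mul_sum, ← hS, ← hsS]
          field_simp
  · refine le_of_eq ?_
    calc ∑ k, ‖((δ / t : ℝ) : 𝕜) • z k‖ ^ 2 = ∑ k, (δ / t) ^ 2 * ‖z k‖ ^ 2 := by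
          refine Finset.sum_congr rfl fun k _ => ?_
          rw [norm_smul, mul_pow, RCLike.norm_ofReal, sq_abs]
      _ = δ ^ 2 := by
          rw [← Finset.mul_sum, ← hZ, ← htZ]
          field_simp

end SummingOperators

/-! ### The Hilbert space norm -/

namespace SummingOperators

variable {𝕜 : Type w} [RCLike 𝕜] {X : Type u} [NormedAddCommGroup X] [NormedSpace 𝕜 X]

variable (𝕜) in
/-- The function `f ↦ |f x|²` on the dual of `X`, standing for the tensor `x ⊗ conj x`. -/
def dualSq (x : X) : StrongDual 𝕜 X → ℝ := fun f => ‖f x‖ ^ 2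

lemma dualSq_sqrt_smul (x : X) {c : ℝ} (hc : 0 ≤ c) :
    dualSq 𝕜 (((√c : ℝ) : 𝕜) • x) = c • dualSq 𝕜 x := by
  ext f
  simp only [dualSq, map_smul, smul_eq_mul, norm_mul, RCLike.norm_ofReal, mul_pow, sq_abs, Real.sq_sqrt hc,
    Pi.smul_apply]

lemma norm_sqrt_smul_sq (x : X) {c : ℝ} (hc : 0 ≤ c) :
    ‖((√c : ℝ) : 𝕜) • x‖ ^ 2 = c * ‖x‖ ^ 2 := by
  rw [norm_smul, RCLike.norm_ofReal, mul_pow, sq_abs, Real.sq_sqrt hc]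

/-- Hahn-Banach, in the form of M. Riesz's extension theorem: the inequality between tuples makes
the functional `(0, r) ↦ r` positive on the cone of the pairs `(T, r)` such that
`T = ∑ |f (zₖ)|² - ∑ |f (xⱼ)|²` and `C ∑ ‖zₖ‖² - ∑ ‖xⱼ‖² ≤ r` for some tuples `z` and `x`. -/
lemma exists_linear_sandwich {C : ℝ} (hC : ∀ z x : Multiset X,
      (z.map (dualSq 𝕜)).sum = (x.map (dualSq 𝕜)).sum →
      (x.map fun y => ‖y‖ ^ 2).sum ≤ C * (z.map fun y => ‖y‖ ^ 2).sum) :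
    ∃ L : (StrongDual 𝕜 X → ℝ) →ₗ[ℝ] ℝ, ∀ x, ‖x‖ ^ 2 ≤ L (dualSq 𝕜 x) ∧
      L (dualSq 𝕜 x) ≤ C * ‖x‖ ^ 2 := by
  let W : Submodule ℝ (StrongDual 𝕜 X → ℝ) := Submodule.span ℝ (Set.range (dualSq 𝕜))
  let P : (StrongDual 𝕜 X → ℝ) → ℝ → Prop := fun T r => ∃ z x : Multiset X,
    T = (z.map (dualSq 𝕜)).sum - (x.map (dualSq 𝕜)).sum ∧
      C * (z.map fun y => ‖y‖ ^ 2).sum - (x.map fun y => ‖y‖ ^ 2).sum ≤ r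
  have hPadd : ∀ {T r T' r'}, P T r → P T' r' → P (T + T') (r + r') := by
    rintro _ r _ r' ⟨z, x, rfl, hr⟩ ⟨z', x', rfl, hr'⟩
    refine ⟨z + z', x + x', ?_, ?_⟩
    · simp only [Multiset.map_add, Multiset.sum_add]
      abel
    · simp only [Multiset.map_add, Multiset.sum_add]
      linarith
  have hPsmul : ∀ {T r} {c : ℝ}, 0 ≤ c → P T r → P (c • T) (c * r) := by
    rintro _ r c hc ⟨z, x, rfl, hr⟩
    have h1 : ∀ s : Multiset X, ((s.map fun y => ((√c : ℝ) : 𝕜) • y).map (dualSq 𝕜)).sum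
        = c • (s.map (dualSq 𝕜)).sum := fun s => by
      rw [Multiset.map_map, Multiset.smul_sum, Multiset.map_map]
      exact congrArg _ (Multiset.map_congr rfl fun y _ => dualSq_sqrt_smul y hc)
    have h2 : ∀ s : Multiset X,
        ((s.map fun y => ((√c : ℝ) : 𝕜) • y).map fun y => ‖y‖ ^ 2).sum
        = c * (s.map fun y => ‖y‖ ^ 2).sum := fun s => by
      rw [Multiset.map_map, ← Multiset.sum_map_mul_left]
      exact congrArg _ (Multiset.map_congr rfl fun y _ => norm_sqrt_smul_sq y hc)
    refine ⟨z.map fun y => ((√c : ℝ) : 𝕜) • y, x.map fun y => ((√c : ℝ) : 𝕜) • y, ?_, ?_⟩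
    · rw [h1, h1, smul_sub]
    · rw [h2, h2]
      nlinarith
  have hPzero : P 0 0 := ⟨0, 0, by simp, by simp⟩
  have hPdense : ∀ T ∈ W, ∃ r, P T r := by
    intro T hT
    induction hT using Submodule.span_induction with
    | mem T hT =>
      obtain ⟨x, rfl⟩ := hT
      exact ⟨_, {x}, 0, by simp, le_rfl⟩
    | zero => exact ⟨0, hPzero⟩
    | add T T' _ _ h h' =>
      obtain ⟨r, hr⟩ := h
      obtain ⟨r', hr'⟩ := h'
      exact ⟨_, hPadd hr hr'⟩
    | smul c T _ h =>
      obtain ⟨r, hr⟩ := h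
      rcases le_total 0 c with hc | hc
      · exact ⟨_, hPsmul hc hr⟩
      · obtain ⟨z, x, hT, -⟩ := hr
        have h1 : P (-T) _ := ⟨x, z, by rw [hT, neg_sub], le_rfl⟩
        have h2 := hPsmul (neg_nonneg.2 hc) h1
        rw [neg_smul_neg] at h2
        exact ⟨_, h2⟩
  let s : PointedCone ℝ (W × ℝ) :=
    PointedCone.ofConeComb {p | P p.1 p.2} ⟨0, hPzero⟩ fun p hp p' hp' a ha b hb =>
      hPadd (hPsmul ha hp) (hPsmul hb hp')
  have hs : ∀ p : W × ℝ, p ∈ s ↔ P p.1 p.2 := fun p => Iff.rfl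
  let D : Submodule ℝ (W × ℝ) := Submodule.prod ⊥ ⊤
  let f : (W × ℝ) →ₗ.[ℝ] ℝ := ⟨D, LinearMap.snd ℝ W ℝ ∘ₗ D.subtype⟩
  obtain ⟨G, hGf, hGs⟩ := riesz_extension s f (fun p hp => by
      obtain ⟨z, x, hT, hr⟩ := (hs _).1 hp
      have h0 : ((p : W × ℝ).1 : StrongDual 𝕜 X → ℝ) = 0 := by
        have : (p : W × ℝ).1 = 0 := p.2.1
        rw [this]
        rfl
      rw [h0] at hT
      have := hC z x (sub_eq_zero.1 hT.symm)
      change 0 ≤ (p : W × ℝ).2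
      linarith) (fun p => by
      obtain ⟨r, hr⟩ := hPdense p.1 p.1.2
      refine ⟨⟨(0, r - p.2), ?_⟩, (hs _).2 ?_⟩
      · exact ⟨rfl, trivial⟩
      · simpa using hr)
  have hG1 : ∀ r : ℝ, G (0, r) = r := fun r => hGf ⟨(0, r), ⟨rfl, trivial⟩⟩
  obtain ⟨L, hL⟩ := (-(G ∘ₗ LinearMap.inl ℝ W ℝ)).exists_extend
  have hmem : ∀ x : X, dualSq 𝕜 x ∈ W := fun x => Submodule.subset_span ⟨x, rfl⟩
  have hLG : ∀ (T : W) (r : ℝ), G (T, r) = r - L T := fun T r => by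
    have h1 : L T = -G (T, 0) := LinearMap.congr_fun hL T
    have h2 : G (T, r) = G (T, 0) + G (0, r) := by
      rw [← map_add]
      simp
    rw [h1, h2, hG1]
    ring
  refine ⟨L, fun x => ⟨?_, ?_⟩⟩
  · have h1 := hGs (-⟨dualSq 𝕜 x, hmem x⟩, -‖x‖ ^ 2) ((hs _).2 ⟨0, {x}, by simp, by simp⟩)
    rw [hLG] at h1
    have h2 : L ((-⟨dualSq 𝕜 x, hmem x⟩ : W) : StrongDual 𝕜 X → ℝ) = -L (dualSq 𝕜 x) :=
      map_neg L _
    linarith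
  · have h1 := hGs (⟨dualSq 𝕜 x, hmem x⟩, C * ‖x‖ ^ 2) ((hs _).2 ⟨{x}, 0, by simp, by simp⟩)
    rw [hLG] at h1
    exact sub_nonneg.1 h1

lemma re_conj_mul_self_eq_dualSq (x : X) :
    (fun f : StrongDual 𝕜 X => RCLike.re ((starRingEnd 𝕜) (f x) * f x)) = dualSq 𝕜 x := by
  ext f
  rw [RCLike.conj_mul, ← RCLike.ofReal_pow, RCLike.ofReal_re]
  rfl

/-- A positive functional on quadratic forms yields the inner product
`⟪x, y⟫ = L (f ↦ conj (f x) * f y)`, with `L` extended to complex valued functions. -/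
@[reducible] noncomputable def innerCore (L : (StrongDual 𝕜 X → ℝ) →ₗ[ℝ] ℝ)
    (hL : ∀ x, ‖x‖ ^ 2 ≤ L (dualSq 𝕜 x)) : InnerProductSpace.Core 𝕜 X where
  inner x y := (L (fun f => RCLike.re ((starRingEnd 𝕜) (f x) * f y)) : 𝕜)
    + (L (fun f => RCLike.im ((starRingEnd 𝕜) (f x) * f y)) : 𝕜) * RCLike.I
  conj_inner_symm x y := by
    have h1 : (fun f : StrongDual 𝕜 X => RCLike.re ((starRingEnd 𝕜) (f y) * f x))
        = fun f => RCLike.re ((starRingEnd 𝕜) (f x) * f y) := by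
      ext f
      simp
      ring
    have h2 : (fun f : StrongDual 𝕜 X => RCLike.im ((starRingEnd 𝕜) (f y) * f x))
        = -fun f => RCLike.im ((starRingEnd 𝕜) (f x) * f y) := by
      ext f
      simp
      ring
    rw [h1, h2, map_neg]
    simp
  re_inner_nonneg x := by
    rw [re_conj_mul_self_eq_dualSq]
    simpa using (sq_nonneg _).trans (hL x)
  add_left x y z := by
    have h1 : (fun f : StrongDual 𝕜 X => RCLike.re ((starRingEnd 𝕜) (f (x + y)) * f z))
        = (fun f => RCLike.re ((starRingEnd 𝕜) (f x) * f z))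
          + fun f => RCLike.re ((starRingEnd 𝕜) (f y) * f z) := by
      ext f
      simp [add_mul]
    have h2 : (fun f : StrongDual 𝕜 X => RCLike.im ((starRingEnd 𝕜) (f (x + y)) * f z))
        = (fun f => RCLike.im ((starRingEnd 𝕜) (f x) * f z))
          + fun f => RCLike.im ((starRingEnd 𝕜) (f y) * f z) := by
      ext f
      simp [add_mul]
    rw [h1, h2, map_add, map_add]
    push_cast
    ring
  smul_left x y c := by
    have h1 : (fun f : StrongDual 𝕜 X => RCLike.re ((starRingEnd 𝕜) (f (c • x)) * f y))
        = RCLike.re c • (fun f => RCLike.re ((starRingEnd 𝕜) (f x) * f y))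
          + RCLike.im c • fun f => RCLike.im ((starRingEnd 𝕜) (f x) * f y) := by
      ext f
      simp
      ring
    have h2 : (fun f : StrongDual 𝕜 X => RCLike.im ((starRingEnd 𝕜) (f (c • x)) * f y))
        = RCLike.re c • (fun f => RCLike.im ((starRingEnd 𝕜) (f x) * f y))
          - RCLike.im c • fun f => RCLike.re ((starRingEnd 𝕜) (f x) * f y) := by
      ext f
      simp
      ring
    rw [h1, h2, map_add, map_sub]
    simp only [map_smul, smul_eq_mul]
    set A := L fun f => RCLike.re ((starRingEnd 𝕜) (f x) * f y)
    set B := L fun f => RCLike.im ((starRingEnd 𝕜) (f x) * f y)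
    -- If `𝕜` is the real field, then `RCLike.I = 0` and both sides of `hI` vanish.
    have hI : (RCLike.im c : 𝕜) * (RCLike.I * RCLike.I) = -(RCLike.im c : 𝕜) := by
      rcases RCLike.I_mul_I (K := 𝕜) with h | h
      · have h3 := RCLike.mul_im_I_ax c
        rw [h, map_zero, mul_zero] at h3
        rw [h, ← h3]
        simp
      · rw [h, mul_neg_one]
    have hc : (starRingEnd 𝕜) c = (RCLike.re c : 𝕜) - (RCLike.im c : 𝕜) * RCLike.I :=
      RCLike.conj_eq_re_sub_im c
    rw [hc]
    push_cast
    linear_combination (B : 𝕜) * hI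
  definite x hx := by
    have h1 := congrArg RCLike.re hx
    rw [re_conj_mul_self_eq_dualSq] at h1
    simp only [map_add, RCLike.ofReal_re, RCLike.re_ofReal_mul, RCLike.I_re, mul_zero, add_zero,
      map_zero] at h1
    have h2 := hL x
    rw [h1] at h2
    exact norm_eq_zero.1 (pow_eq_zero_iff two_ne_zero |>.1 (le_antisymm h2 (sq_nonneg _)))

lemma re_innerCore_self (L : (StrongDual 𝕜 X → ℝ) →ₗ[ℝ] ℝ)
    (hL : ∀ x, ‖x‖ ^ 2 ≤ L (dualSq 𝕜 x)) (x : X) :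
    RCLike.re ((innerCore L hL).inner x x) = L (dualSq 𝕜 x) := by
  change RCLike.re ((L (fun f => RCLike.re ((starRingEnd 𝕜) (f x) * f x)) : 𝕜)
    + (L (fun f => RCLike.im ((starRingEnd 𝕜) (f x) * f x)) : 𝕜) * RCLike.I) = _
  rw [re_conj_mul_self_eq_dualSq]
  simp

/-- An inner product on a linear copy `H` of `X`, with norm equivalent to that of `X`. The copy keeps
the norm of `X` apart from the new one. -/
lemma isIsomorphicToHilbert_of_core [CompleteSpace X] {H : Type u} [AddCommGroup H] [Module 𝕜 H]
    (c : InnerProductSpace.Core 𝕜 H) (e : X ≃ₗ[𝕜] H) {C : ℝ} (hC : 0 ≤ C)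
    (h1 : ∀ x, ‖x‖ ^ 2 ≤ RCLike.re (c.inner (e x) (e x)))
    (h2 : ∀ x, RCLike.re (c.inner (e x) (e x)) ≤ C * ‖x‖ ^ 2) : IsIsomorphicToHilbert 𝕜 X := by
  let : NormedAddCommGroup H := c.toNormedAddCommGroup
  let : InnerProductSpace 𝕜 H := InnerProductSpace.ofCore c.toCore
  have hn : ∀ y : H, ‖y‖ ^ 2 = RCLike.re (c.inner y y) := fun y =>
    InnerProductSpace.norm_sq_eq_re_inner (𝕜 := 𝕜) y
  let E : X ≃L[𝕜] H := e.toContinuousLinearEquivOfBounds (√C) 1 (fun x => by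
      refine le_of_sq_le_sq ?_ (by positivity)
      rw [hn, mul_pow, Real.sq_sqrt hC]
      exact h2 x) (fun y => by
      rw [one_mul]
      refine le_of_sq_le_sq ?_ (norm_nonneg _)
      rw [hn]
      simpa using h1 (e.symm y))
  have hH : CompleteSpace H := (completeSpace_congr (e := E.toEquiv) E.isUniformEmbedding).1 ‹_›
  exact ⟨H, inferInstance, inferInstance, hH, ⟨E⟩⟩

lemma exists_fin_map_eq {α : Type*} (s : Multiset α) :
    ∃ (n : ℕ) (z : Fin n → α), ∀ F : α → ℝ, (s.map F).sum = ∑ k, F (z k) := by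
  induction s using Quotient.inductionOn with
  | h l =>
    refine ⟨l.length, l.get, fun F => ?_⟩
    simp [← List.sum_ofFn]

/-- If almost summing operators on `X` are Cohen strongly `2`-summing, then `X` is isomorphic to a
Hilbert space. -/
lemma isIsomorphicToHilbert_of_almostSumming_subset [CompleteSpace X]
    (h : ∀ (Y : Type v) [NormedAddCommGroup Y] [NormedSpace 𝕜 Y] [CompleteSpace Y],
      almostSumming 𝕜 X Y ⊆ cohenStronglySumming 𝕜 X Y 2) : IsIsomorphicToHilbert 𝕜 X := by
  obtain ⟨δ, hδ, htr⟩ := exists_trace_bound h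
  obtain ⟨L, hL⟩ := exists_linear_sandwich (𝕜 := 𝕜) (X := X) (C := (δ ^ 4)⁻¹) fun z x hzx => by
    obtain ⟨n, z', hz⟩ := exists_fin_map_eq z
    obtain ⟨m, x', hx⟩ := exists_fin_map_eq x
    rw [hz fun y => ‖y‖ ^ 2, hx fun y => ‖y‖ ^ 2]
    refine (le_inv_mul_iff₀ (by positivity)).2 (exists_sum_norm_sq_le hδ htr x' z' fun f => ?_)
    have h1 := congrFun hzx f
    have h2 : ∀ s : Multiset X, (s.map (dualSq 𝕜)).sum f = (s.map fun y => ‖f y‖ ^ 2).sum :=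
      fun s => by
        refine (map_multiset_sum (Pi.evalAddMonoidHom (fun _ => ℝ) f) _).trans ?_
        rw [Multiset.map_map]
        rfl
    rw [h2, h2, hz, hx] at h1
    exact h1.symm
  refine isIsomorphicToHilbert_of_core (innerCore L fun x => (hL x).1) (LinearEquiv.refl 𝕜 X)
    (C := (δ ^ 4)⁻¹) (by positivity) (fun x => ?_) fun x => ?_
  · exact (hL x).1.trans_eq (re_innerCore_self L _ x).symm
  · exact (re_innerCore_self L _ x).trans_le (hL x).2

end SummingOperators

theorem theorem4p1 (𝕜 : Type w) [RCLike 𝕜]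
    (X : Type u) [NormedAddCommGroup X] [NormedSpace 𝕜 X] [CompleteSpace X] :
    List.TFAE [
      SummingOperators.IsIsomorphicToHilbert 𝕜 X,
      ∀ q : ℝ≥0∞, 1 < q →
        ∀ (Y : Type v) [NormedAddCommGroup Y] [NormedSpace 𝕜 Y] [CompleteSpace Y],
          SummingOperators.almostSumming 𝕜 X Y ⊆ SummingOperators.cohenStronglySumming 𝕜 X Y q,
      ∀ (Y : Type v) [NormedAddCommGroup Y] [NormedSpace 𝕜 Y] [CompleteSpace Y],
        SummingOperators.almostSumming 𝕜 X Y ⊆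
          SummingOperators.cohenStronglySumming 𝕜 X Y 2] := by
  tfae_have 1 → 2 := fun h q hq Y _ _ _ =>
    SummingOperators.almostSumming_subset_cohenStronglySumming h hq Y
  tfae_have 2 → 3 := fun h Y _ _ _ => h 2 (by norm_num) Y
  tfae_have 3 → 1 := fun h => SummingOperators.isIsomorphicToHilbert_of_almostSumming_subset h
  tfae_finish
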